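/- **Definitions.** All graphs are finite and simple; $x\simeq y$ means that the vertices $x,y$ are adjacent or equal. Let $\mathcal G$ be the semiring of isomorphism classes of graphs, with disjoint union as addition and strong product as multiplication, preordered by $H\le G$ iff there is a graph homomorphism $\overline H\to\overline G$ between the complements. A *noncommutative graph* is a subspace $S\subseteq B(\mathcal H)$ of the operators on a finite-dimensional complex Hilbert space with $I\in S$ and $S^*=S$; two of them are isomorphic if $USU^*=T$ for some unitary $U$. Let $\mathcal G_{\mathrm{nc}}$ be the semiring of isomorphism classes of noncommutative graphs, with direct sum $S\oplus T=\{A\oplus B: A\in S, B\in T\}$ and tensor product $S\otimes T=\operatorname{span}\{A\otimes B: A\in S, B\in T\}$, preordered as follows: for $T\subseteq B(\mathcal K)$ and $S\subseteq B(\mathcal H)$, $T\le S$ iff there are finitely many linear maps $E_i:\mathcal K\to\mathcal H$ with $\sum_i E_i^*E_i=I$ and $E_i^*SE_j\subseteq T$ for all $i,j$. A graph $G$ is regarded as the noncommutative graph $\mathcal S_G=\operatorname{span}\{|x\rangle\langle x'| : x\simeq x'\}\subseteq B(\mathbb C^{V(G)})$, which gives a semiring homomorphism $\mathcal G\to\mathcal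 G_{\mathrm{nc}}$. Let $\mathcal Q_d=\mathbb C I\subseteq B(\mathbb C^d)$ for $d\in\mathbb N$ (the confusability graph of the noiseless $d$-dimensional quantum channel). Let $\mathcal A\subseteq\mathcal G_{\mathrm{nc}}$ be the subsemiring generated by all $\mathcal S_G$ and all $\mathcal Q_d$, with the restricted preorder. For a preordered semiring $(R,\le)$, let $\Delta(R,\le)$ be the set of monotone semiring homomorphisms $R\to\mathbb R_{\ge0}$ (its asymptotic spectrum). For a graph parameter $f:\mathcal G\to\mathbb R$, a real number $\alpha\ge1$ is an *admissible exponent* if there is an $F\in\Delta(\mathcal A,\le)$ with $F\bigl(\bigoplus_{d=1}^r \mathcal S_{G_d}\otimes\mathcal Q_d\bigr)=\sum_{d=1}^r f(G_d)\,d^\alpha$ for all $r$ and all graphs $G_1,\dots,G_r$. The fractional clique cover number is $\overline{\chi_f}(G)=\chi_f(\overline G)$, where the fractional chromatic number $\chi_f(H)$ is the infimum of $\sum_I w(I)$ over nonnegative weights $w$ on the independent sets $I$ of $H$ such that $\sum_{I\ni v}w(I)\ge1$ for every vertex $v$. **Proposition.** The fractional clique cover number does not extend to an element of $\Delta(\mathcal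 A,\le)$: there is no $F\in\Delta(\mathcal A,\le)$ with $F(\mathcal S_G)=\overline{\chi_f}(G)$ for every graph $G$. In particular, no $\alpha\in[1,\infty)$ is an admissible exponent for $\overline{\chi_f}$. -/

import Mathlib

open scoped Matrix Kronecker NNReal

noncomputable section

/-! ## Finite graphs, strong product, cohomomorphisms -/

/-- A finite simple undirected graph. -/
structure FinGraph where
  V : Type
  [fintypeV : Fintype V]
  [decEqV : DecidableEq V]
  graph : SimpleGraph V

attribute [instance] FinGraph.fintypeV FinGraph.decEqV

/-- The relation "adjacent or equal". -/
def AdjEq {V : Type} (G : SimpleGraph V) (x y : V) : Prop := x = y ∨ G.Adj x y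

theorem AdjEq.symm {V : Type} {G : SimpleGraph V} {x y : V} (h : AdjEq G x y) : AdjEq G y x :=
  h.elim (fun h => Or.inl h.symm) (fun h => Or.inr h.symm)

theorem adjEq_refl {V : Type} (G : SimpleGraph V) (x : V) : AdjEq G x x := Or.inl rfl

theorem adj_iff_adjEq {V : Type} {G : SimpleGraph V} {x y : V} :
    G.Adj x y ↔ x ≠ y ∧ AdjEq G x y :=
  ⟨fun h => ⟨h.ne, Or.inr h⟩, fun h => h.2.resolve_left h.1⟩

theorem adjEq_iso {V W : Type} {G : SimpleGraph V} {H : SimpleGraph W} (e : G ≃g H) {x y : V} :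
    AdjEq H (e x) (e y) ↔ AdjEq G x y := by
  rw [AdjEq, AdjEq, e.apply_eq_iff_eq, e.map_adj_iff]

/-- A bijection preserving "adjacent or equal" is a graph isomorphism. -/
def isoOfAdjEq {V W : Type} {G : SimpleGraph V} {H : SimpleGraph W} (e : V ≃ W)
    (h : ∀ x y, AdjEq H (e x) (e y) ↔ AdjEq G x y) : G ≃g H where
  toEquiv := e
  map_rel_iff' := by
    intro x y
    rw [adj_iff_adjEq, adj_iff_adjEq, h, Ne, e.apply_eq_iff_eq]

/-- The strong product of two graphs. -/
def strongProd {V W : Type} (G : SimpleGraph V) (H : SimpleGraph W) : SimpleGraph (V × W) where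
  Adj p q := p ≠ q ∧ AdjEq G p.1 q.1 ∧ AdjEq H p.2 q.2
  symm := ⟨fun _ _ h => ⟨h.1.symm, h.2.1.symm, h.2.2.symm⟩⟩
  loopless := ⟨fun _ h => h.1 rfl⟩

theorem adjEq_strongProd {V W : Type} {G : SimpleGraph V} {H : SimpleGraph W} {p q : V × W} :
    AdjEq (strongProd G H) p q ↔ AdjEq G p.1 q.1 ∧ AdjEq H p.2 q.2 := by
  by_cases h : p = q
  · subst h; simp [adjEq_refl]
  · simp [AdjEq, strongProd, h]

theorem adjEq_sum_inl {V W : Type} {G : SimpleGraph V} {H : SimpleGraph W} {x y : V} :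
    AdjEq (G ⊕g H) (.inl x) (.inl y) ↔ AdjEq G x y := by simp [AdjEq]

theorem adjEq_sum_inr {V W : Type} {G : SimpleGraph V} {H : SimpleGraph W} {x y : W} :
    AdjEq (G ⊕g H) (.inr x) (.inr y) ↔ AdjEq H x y := by simp [AdjEq]

theorem adjEq_sum_inl_inr {V W : Type} {G : SimpleGraph V} {H : SimpleGraph W} {x : V} {y : W} :
    AdjEq (G ⊕g H) (.inl x) (.inr y) ↔ False := by simp [AdjEq]

theorem adjEq_sum_inr_inl {V W : Type} {G : SimpleGraph V} {H : SimpleGraph W} {x : W} {y : V} :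
    AdjEq (G ⊕g H) (.inr x) (.inl y) ↔ False := by simp [AdjEq]

/-- Isomorphic graphs have isomorphic complements. -/
def complIso {V W : Type} {G : SimpleGraph V} {H : SimpleGraph W} (e : G ≃g H) : Gᶜ ≃g Hᶜ where
  toEquiv := e.toEquiv
  map_rel_iff' := by
    intro a b
    have h : H.Adj (e.toEquiv a) (e.toEquiv b) ↔ G.Adj a b := e.map_adj_iff
    rw [SimpleGraph.compl_adj, SimpleGraph.compl_adj, h, Ne, e.toEquiv.apply_eq_iff_eq]

def strongOneIso {V : Type} (G : SimpleGraph V) : strongProd (⊥ : SimpleGraph Unit) G ≃g G :=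
  isoOfAdjEq (Equiv.punitProd V) (by
    rintro ⟨⟨⟩, x⟩ ⟨⟨⟩, y⟩
    simp [adjEq_strongProd, adjEq_refl, Equiv.punitProd])

def strongEmptyIso {V : Type} (G : SimpleGraph V) :
    strongProd (⊥ : SimpleGraph Empty) G ≃g (⊥ : SimpleGraph Empty) :=
  isoOfAdjEq (Equiv.equivOfIsEmpty _ _) (fun x => x.1.elim)

def strongSumIso {V W X : Type} (G : SimpleGraph V) (H : SimpleGraph W) (K : SimpleGraph X) :
    strongProd G (H ⊕g K) ≃g strongProd G H ⊕g strongProd G K :=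
  isoOfAdjEq (Equiv.prodSumDistrib V W X) (by
    rintro ⟨x, (x' | x')⟩ ⟨y, (y' | y')⟩ <;>
    simp [adjEq_strongProd, adjEq_sum_inl, adjEq_sum_inr, adjEq_sum_inl_inr, adjEq_sum_inr_inl,
      Equiv.prodSumDistrib, Equiv.sumProdDistrib])

namespace FinGraph

/-- Graph isomorphism. -/
def Iso (G H : FinGraph) : Prop := Nonempty (G.graph ≃g H.graph)

instance setoid : Setoid FinGraph where
  r := Iso
  iseqv := ⟨fun _ => ⟨RelIso.refl _⟩, fun ⟨e⟩ => ⟨e.symm⟩, fun ⟨e⟩ ⟨f⟩ => ⟨e.trans f⟩⟩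

/-- Disjoint union. -/
def disjUnion (G H : FinGraph) : FinGraph := ⟨G.V ⊕ H.V, G.graph ⊕g H.graph⟩

/-- Strong product. -/
def strong (G H : FinGraph) : FinGraph := ⟨G.V × H.V, strongProd G.graph H.graph⟩

/-- The graph without vertices. -/
def empty : FinGraph := ⟨Empty, ⊥⟩

/-- The graph with a single vertex. -/
def single : FinGraph := ⟨Unit, ⊥⟩

/-- `G.Cohom H` (written `G ≤ H` on isomorphism classes): there is a cohomomorphism from `G` to `H`,
that is, a homomorphism between the complements. -/
def Cohom (G H : FinGraph) : Prop := Nonempty (G.graphᶜ →g H.graphᶜ)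

theorem Cohom.trans {G H K : FinGraph} : G.Cohom H → H.Cohom K → G.Cohom K :=
  fun ⟨e⟩ ⟨f⟩ => ⟨f.comp e⟩

theorem Iso.cohom {G H : FinGraph} : G.Iso H → G.Cohom H := by
  rintro ⟨e⟩
  exact ⟨(complIso e).toHom⟩

theorem iso_disjUnion {G G' H H' : FinGraph} :
    G.Iso G' → H.Iso H' → (disjUnion G H).Iso (disjUnion G' H') := by
  rintro ⟨e⟩ ⟨f⟩
  refine ⟨isoOfAdjEq (Equiv.sumCongr e.toEquiv f.toEquiv) ?_⟩
  rintro (x | x) (y | y)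
  · exact adjEq_sum_inl.trans ((adjEq_iso e).trans adjEq_sum_inl.symm)
  · exact adjEq_sum_inl_inr.trans adjEq_sum_inl_inr.symm
  · exact adjEq_sum_inr_inl.trans adjEq_sum_inr_inl.symm
  · exact adjEq_sum_inr.trans ((adjEq_iso f).trans adjEq_sum_inr.symm)

theorem iso_strong {G G' H H' : FinGraph} :
    G.Iso G' → H.Iso H' → (strong G H).Iso (strong G' H') := by
  rintro ⟨e⟩ ⟨f⟩
  refine ⟨isoOfAdjEq (Equiv.prodCongr e.toEquiv f.toEquiv) ?_⟩
  intro x y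
  exact adjEq_strongProd.trans ((and_congr (adjEq_iso e) (adjEq_iso f)).trans adjEq_strongProd.symm)

end FinGraph

/-- The set `𝒢` of isomorphism classes of finite graphs. -/
def GraphClass : Type 1 := Quotient FinGraph.setoid

namespace GraphClass

instance : Zero GraphClass := ⟨Quotient.mk _ FinGraph.empty⟩
instance : One GraphClass := ⟨Quotient.mk _ FinGraph.single⟩
instance : Add GraphClass :=
  ⟨Quotient.map₂ FinGraph.disjUnion fun _ _ h _ _ h' => FinGraph.iso_disjUnion h h'⟩
instance : Mul GraphClass :=
  ⟨Quotient.map₂ FinGraph.strong fun _ _ h _ _ h' => FinGraph.iso_strong h h'⟩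

protected theorem add_comm' (a b : GraphClass) : a + b = b + a := by
  induction a using Quotient.inductionOn with | _ G
  induction b using Quotient.inductionOn with | _ H
  exact Quotient.sound ⟨SimpleGraph.Iso.sumComm⟩

protected theorem zero_add' (a : GraphClass) : 0 + a = a := by
  induction a using Quotient.inductionOn with | _ G
  refine Quotient.sound ⟨isoOfAdjEq (Equiv.emptySum Empty G.V) ?_⟩
  rintro (x | x) (y | y)
  · exact x.elim
  · exact x.elim
  · exact y.elim
  · exact adjEq_sum_inr.symm

protected theorem mul_comm' (a b : GraphClass) : a * b = b * a := by
  induction a using Quotient.inductionOn with | _ G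
  induction b using Quotient.inductionOn with | _ H
  refine Quotient.sound ⟨isoOfAdjEq (Equiv.prodComm G.V H.V) ?_⟩
  intro x y
  exact adjEq_strongProd.trans (and_comm.trans adjEq_strongProd.symm)

protected theorem one_mul' (a : GraphClass) : 1 * a = a := by
  induction a using Quotient.inductionOn with | _ G
  exact Quotient.sound ⟨strongOneIso G.graph⟩

protected theorem zero_mul' (a : GraphClass) : 0 * a = 0 := by
  induction a using Quotient.inductionOn with | _ G
  exact Quotient.sound ⟨strongEmptyIso G.graph⟩

protected theorem left_distrib' (a b c : GraphClass) : a * (b + c) = a * b + a * c := by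
  induction a using Quotient.inductionOn with | _ G
  induction b using Quotient.inductionOn with | _ H
  induction c using Quotient.inductionOn with | _ K
  exact Quotient.sound ⟨strongSumIso G.graph H.graph K.graph⟩

/-- The semiring of graphs: disjoint union as addition, strong product as multiplication. -/
instance : CommSemiring GraphClass where
  add_assoc a b c := by
    induction a using Quotient.inductionOn with | _ G
    induction b using Quotient.inductionOn with | _ H
    induction c using Quotient.inductionOn with | _ K
    exact Quotient.sound ⟨SimpleGraph.Iso.sumAssoc⟩
  zero_add := GraphClass.zero_add'
  add_zero a := (GraphClass.add_comm' a 0).trans (GraphClass.zero_add' a)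
  add_comm := GraphClass.add_comm'
  nsmul := nsmulRec
  mul_assoc a b c := by
    induction a using Quotient.inductionOn with | _ G
    induction b using Quotient.inductionOn with | _ H
    induction c using Quotient.inductionOn with | _ K
    refine Quotient.sound ⟨isoOfAdjEq (Equiv.prodAssoc G.V H.V K.V) ?_⟩
    intro x y
    refine adjEq_strongProd.trans ((and_congr_right' adjEq_strongProd).trans
      (and_assoc.symm.trans ?_))
    exact (and_congr_left' adjEq_strongProd.symm).trans adjEq_strongProd.symm
  one_mul := GraphClass.one_mul'
  mul_one a := (GraphClass.mul_comm' a 1).trans (GraphClass.one_mul' a)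
  left_distrib := GraphClass.left_distrib'
  right_distrib a b c := by
    rw [GraphClass.mul_comm', GraphClass.left_distrib', GraphClass.mul_comm' c a,
      GraphClass.mul_comm' c b]
  zero_mul := GraphClass.zero_mul'
  mul_zero a := (GraphClass.mul_comm' a 0).trans (GraphClass.zero_mul' a)
  mul_comm := GraphClass.mul_comm'

/-- The cohomomorphism preorder on graphs. -/
instance : Preorder GraphClass where
  le := Quotient.lift₂ FinGraph.Cohom fun _ _ _ _ h h' => propext
    ⟨fun k => (FinGraph.Iso.cohom (Setoid.symm h)).trans (k.trans (FinGraph.Iso.cohom h')),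
      fun k => (FinGraph.Iso.cohom h).trans (k.trans (FinGraph.Iso.cohom (Setoid.symm h')))⟩
  le_refl a := by
    induction a using Quotient.inductionOn with | _ G
    exact FinGraph.Iso.cohom (Setoid.refl G)
  le_trans a b c := by
    induction a using Quotient.inductionOn with | _ G
    induction b using Quotient.inductionOn with | _ H
    induction c using Quotient.inductionOn with | _ K
    exact FinGraph.Cohom.trans

end GraphClass

/-! ## The fractional clique cover number -/

/-- The values `∑ w(I)` of fractional colourings `w` of `G`: nonnegative weights on the independent
sets such that every vertex is covered with total weight at least `1`. -/
def fractionalColoringValues {V : Type} [Fintype V] [DecidableEq V] (G : SimpleGraph V) : Set ℝ :=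
  {t | ∃ w : Finset V → ℝ, (∀ I, 0 ≤ w I) ∧ (∀ I, w I ≠ 0 → G.IsIndepSet (I : Set V)) ∧
    (∀ v, 1 ≤ ∑ I : Finset V, if v ∈ I then w I else 0) ∧ t = ∑ I : Finset V, w I}

/-- The fractional chromatic number `χ_f`. -/
def fractionalChromaticNumber {V : Type} [Fintype V] [DecidableEq V] (G : SimpleGraph V) : ℝ :=
  sInf (fractionalColoringValues G)

theorem fractionalColoringValues_subset_of_iso {V W : Type} [Fintype V] [DecidableEq V] [Fintype W]
    [DecidableEq W] {G : SimpleGraph V} {H : SimpleGraph W} (e : G ≃g H) :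
    fractionalColoringValues G ⊆ fractionalColoringValues H := by
  rintro t ⟨w, h0, h1, h2, rfl⟩
  refine ⟨fun I => w (I.map e.symm.toEquiv.toEmbedding), fun I => h0 _, ?_, ?_, ?_⟩
  · intro I hI x hx y hy hxy hadj
    have := h1 _ hI (x := e.symm x) (by simpa using hx) (y := e.symm y) (by simpa using hy)
      (by simpa using hxy)
    exact this (e.symm.map_adj_iff.2 hadj)
  · intro v
    refine (h2 (e.symm v)).trans (le_of_eq ?_)
    refine (Equiv.sum_comp (Equiv.finsetCongr e.symm.toEquiv) _).symm.trans ?_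
    refine Finset.sum_congr rfl fun I _ => ?_
    have : e.symm v ∈ I.map e.symm.toEquiv.toEmbedding ↔ v ∈ I := by
      simp [RelIso.symm]
    simp only [Equiv.finsetCongr_apply, this]
  · exact (Equiv.sum_comp (Equiv.finsetCongr e.symm.toEquiv) _).symm

/-- The fractional clique cover number: the fractional chromatic number of the complement. -/
def fractionalCliqueCover : GraphClass → ℝ :=
  Quotient.lift (fun G => fractionalChromaticNumber G.graphᶜ) fun _ _ h => by
    obtain ⟨e⟩ := h
    exact congrArg sInf (Set.Subset.antisymm
      (fractionalColoringValues_subset_of_iso (complIso e))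
      (fractionalColoringValues_subset_of_iso (complIso e).symm))

/-! ## Operator spaces: direct sums, tensor products, isomorphisms, cohomomorphisms

Operators on the Hilbert space `ℂ^V` are written as matrices indexed by `V`; every finite
dimensional Hilbert space is of this form up to a unitary. -/

/-- A space of operators on `ℂ^V`. -/
abbrev OpSpace (V : Type) := Submodule ℂ (Matrix V V ℂ)

/-- `S ⊕ T = {A ⊕ B | A ∈ S, B ∈ T}`. -/
def sumSpace {V W : Type} (S : OpSpace V) (T : OpSpace W) : OpSpace (V ⊕ W) where
  carrier := {M | ∃ A ∈ S, ∃ B ∈ T, M = Matrix.fromBlocks A 0 0 B}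
  zero_mem' := ⟨0, S.zero_mem, 0, T.zero_mem, by simp⟩
  add_mem' := by
    rintro _ _ ⟨A, hA, B, hB, rfl⟩ ⟨A', hA', B', hB', rfl⟩
    exact ⟨A + A', S.add_mem hA hA', B + B', T.add_mem hB hB', by simp [Matrix.fromBlocks_add]⟩
  smul_mem' := by
    rintro c _ ⟨A, hA, B, hB, rfl⟩
    exact ⟨c • A, S.smul_mem c hA, c • B, T.smul_mem c hB, by simp [Matrix.fromBlocks_smul]⟩

/-- `S ⊗ T = span {A ⊗ B | A ∈ S, B ∈ T}`. -/
def tensorSpace {V W : Type} (S : OpSpace V) (T : OpSpace W) : OpSpace (V × W) :=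
  Submodule.span ℂ {M | ∃ A ∈ S, ∃ B ∈ T, M = A ⊗ₖ B}

/-- `span {|x⟩⟨y| : x ≃ y}`. -/
def graphSpace {V : Type} [DecidableEq V] (G : SimpleGraph V) : OpSpace V :=
  Submodule.span ℂ {M | ∃ x y, AdjEq G x y ∧ M = Matrix.single x y 1}

/-- There is a unitary `U : ℂ^V → ℂ^W` with `U S U* = T`. -/
def SpaceIso {V W : Type} [Fintype V] [DecidableEq V] [Fintype W] [DecidableEq W]
    (S : OpSpace V) (T : OpSpace W) : Prop :=
  ∃ U : Matrix W V ℂ, Uᴴ * U = 1 ∧ U * Uᴴ = 1 ∧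
    (fun A : Matrix V V ℂ => U * A * Uᴴ) '' (S : Set (Matrix V V ℂ)) = (T : Set (Matrix W W ℂ))

/-- `SpaceCohom T S` (written `T ≤ S` on isomorphism classes): there are linear maps
`E i : ℂ^V → ℂ^W` with `∑ E i* E i = 1` and `E i* S E j ⊆ T`. -/
def SpaceCohom {V W : Type} [Fintype V] [DecidableEq V] [Fintype W] [DecidableEq W]
    (T : OpSpace V) (S : OpSpace W) : Prop :=
  ∃ (ι : Type) (_ : Fintype ι) (E : ι → Matrix W V ℂ), ∑ i, (E i)ᴴ * E i = 1 ∧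
    ∀ i j, ∀ A ∈ S, (E i)ᴴ * A * E j ∈ T

section Spaces

variable {V W X Y : Type} [Fintype V] [DecidableEq V] [Fintype W] [DecidableEq W]
  [Fintype X] [DecidableEq X] [Fintype Y] [DecidableEq Y]

theorem SpaceIso.of {S : OpSpace V} {T : OpSpace W} (U : Matrix W V ℂ) (h1 : Uᴴ * U = 1)
    (h2 : U * Uᴴ = 1) (h3 : ∀ A ∈ S, U * A * Uᴴ ∈ T) (h4 : ∀ B ∈ T, Uᴴ * B * U ∈ S) :
    SpaceIso S T := by
  refine ⟨U, h1, h2, Set.Subset.antisymm ?_ ?_⟩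
  · rintro _ ⟨A, hA, rfl⟩
    exact h3 A hA
  · intro B hB
    refine ⟨_, h4 B hB, ?_⟩
    calc U * (Uᴴ * B * U) * Uᴴ = (U * Uᴴ) * B * (U * Uᴴ) := by simp only [Matrix.mul_assoc]
      _ = B := by rw [h2, Matrix.one_mul, Matrix.mul_one]

theorem SpaceIso.elim {S : OpSpace V} {T : OpSpace W} (h : SpaceIso S T) :
    ∃ U : Matrix W V ℂ, Uᴴ * U = 1 ∧ U * Uᴴ = 1 ∧ (∀ A ∈ S, U * A * Uᴴ ∈ T) ∧
      (∀ B ∈ T, Uᴴ * B * U ∈ S) := by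
  obtain ⟨U, h1, h2, h3⟩ := h
  refine ⟨U, h1, h2, fun A hA => ?_, fun B hB => ?_⟩
  · have : U * A * Uᴴ ∈ (T : Set (Matrix W W ℂ)) := h3 ▸ ⟨A, hA, rfl⟩
    exact this
  · have : B ∈ (T : Set (Matrix W W ℂ)) := hB
    rw [← h3] at this
    obtain ⟨A, hA, rfl⟩ := this
    have : Uᴴ * (U * A * Uᴴ) * U = A := by
      calc Uᴴ * (U * A * Uᴴ) * U = (Uᴴ * U) * A * (Uᴴ * U) := by simp only [Matrix.mul_assoc]
        _ = A := by rw [h1, Matrix.one_mul, Matrix.mul_one]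
    rw [this]
    exact hA

theorem SpaceIso.refl (S : OpSpace V) : SpaceIso S S :=
  SpaceIso.of 1 (by simp) (by simp) (by simp) (by simp)

theorem SpaceIso.symm {S : OpSpace V} {T : OpSpace W} (h : SpaceIso S T) : SpaceIso T S := by
  obtain ⟨U, h1, h2, h3, h4⟩ := h.elim
  exact SpaceIso.of Uᴴ (by simpa using h2) (by simpa using h1) (by simpa using h4)
    (by simpa using h3)

theorem SpaceIso.trans {S : OpSpace V} {T : OpSpace W} {R : OpSpace X} (h : SpaceIso S T)
    (k : SpaceIso T R) : SpaceIso S R := by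
  obtain ⟨U, h1, h2, h3, h4⟩ := h.elim
  obtain ⟨U', k1, k2, k3, k4⟩ := k.elim
  refine SpaceIso.of (U' * U) ?_ ?_ (fun A hA => ?_) (fun B hB => ?_)
  · calc (U' * U)ᴴ * (U' * U) = Uᴴ * (U'ᴴ * U') * U := by
          simp only [Matrix.conjTranspose_mul, Matrix.mul_assoc]
      _ = 1 := by rw [k1, Matrix.mul_one, h1]
  · calc (U' * U) * (U' * U)ᴴ = U' * (U * Uᴴ) * U'ᴴ := by
          simp only [Matrix.conjTranspose_mul, Matrix.mul_assoc]
      _ = 1 := by rw [h2, Matrix.mul_one, k2]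
  · simpa only [Matrix.conjTranspose_mul, Matrix.mul_assoc] using k3 _ (h3 A hA)
  · simpa only [Matrix.conjTranspose_mul, Matrix.mul_assoc] using h4 _ (k4 B hB)

theorem SpaceIso.of_equiv {S : OpSpace V} {T : OpSpace W} (e : V ≃ W)
    (h : ∀ A ∈ S, A.submatrix e.symm e.symm ∈ T) (h' : ∀ B ∈ T, B.submatrix e e ∈ S) :
    SpaceIso S T := by
  have key : ∀ A : Matrix V V ℂ, (1 : Matrix V V ℂ).submatrix e.symm id * A *
      ((1 : Matrix V V ℂ).submatrix e.symm id)ᴴ = A.submatrix e.symm e.symm := by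
    intro A
    ext x y
    simp [Matrix.mul_apply, Matrix.one_apply]
  have key' : ∀ B : Matrix W W ℂ, ((1 : Matrix V V ℂ).submatrix e.symm id)ᴴ * B *
      ((1 : Matrix V V ℂ).submatrix e.symm id) = B.submatrix e e := by
    intro A
    ext x y
    simp [Matrix.mul_apply, Matrix.one_apply, Equiv.eq_symm_apply, Equiv.symm_apply_eq]
  refine SpaceIso.of ((1 : Matrix V V ℂ).submatrix e.symm id) ?_ ?_ (fun A hA => ?_)
    (fun B hB => ?_)
  · simp
  · have := key 1
    rw [Matrix.mul_one] at this
    rw [this]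
    simp
  · simpa only [key] using h A hA
  · simpa only [key'] using h' B hB

theorem SpaceCohom.trans {R : OpSpace V} {S : OpSpace W} {T : OpSpace X} (h : SpaceCohom R S)
    (k : SpaceCohom S T) : SpaceCohom R T := by
  obtain ⟨ι, _, E, h1, h2⟩ := h
  obtain ⟨κ, _, F, k1, k2⟩ := k
  refine ⟨ι × κ, inferInstance, fun p => F p.2 * E p.1, ?_, ?_⟩
  · rw [Fintype.sum_prod_type, ← h1]
    refine Finset.sum_congr rfl fun i _ => ?_
    calc ∑ j, (F j * E i)ᴴ * (F j * E i) = (E i)ᴴ * (∑ j, (F j)ᴴ * F j) * E i := by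
          simp only [Matrix.conjTranspose_mul, Matrix.mul_assoc, Matrix.mul_sum, Matrix.sum_mul]
      _ = (E i)ᴴ * E i := by rw [k1, Matrix.mul_one]
  · rintro ⟨i, i'⟩ ⟨j, j'⟩ A hA
    simpa only [Matrix.conjTranspose_mul, Matrix.mul_assoc] using h2 i j _ (k2 i' j' A hA)

theorem SpaceIso.cohom {S : OpSpace V} {T : OpSpace W} (h : SpaceIso S T) : SpaceCohom S T := by
  obtain ⟨U, h1, h2, h3, h4⟩ := h.elim
  exact ⟨Unit, inferInstance, fun _ => U, by simpa using h1, fun _ _ A hA => h4 A hA⟩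

theorem kron_mem {V' W' : Type} {S : OpSpace V'} {T : OpSpace W'} {A : Matrix V' V' ℂ}
    {B : Matrix W' W' ℂ} (hA : A ∈ S) (hB : B ∈ T) : A ⊗ₖ B ∈ tensorSpace S T :=
  Submodule.subset_span ⟨A, hA, B, hB, rfl⟩

/-- A linear map that sends all `A ⊗ B` into `R` sends `S ⊗ T` into `R`. -/
theorem tensorSpace_induction {V' W' X' : Type} {S : OpSpace V'} {T : OpSpace W'} {R : OpSpace X'}
    (L : Matrix (V' × W') (V' × W') ℂ →ₗ[ℂ] Matrix X' X' ℂ)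
    (h : ∀ A ∈ S, ∀ B ∈ T, L (A ⊗ₖ B) ∈ R) :
    ∀ M ∈ tensorSpace S T, L M ∈ R := by
  have : tensorSpace S T ≤ R.comap L := by
    refine Submodule.span_le.2 ?_
    rintro _ ⟨A, hA, B, hB, rfl⟩
    exact h A hA B hB
  exact fun M hM => this hM

/-- `M ↦ U M U'` as a linear map. -/
def sandwich {V' W' : Type} [Fintype V'] (U : Matrix W' V' ℂ) (U' : Matrix V' W' ℂ) :
    Matrix V' V' ℂ →ₗ[ℂ] Matrix W' W' ℂ where
  toFun M := U * M * U'
  map_add' A B := by rw [Matrix.mul_add, Matrix.add_mul]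
  map_smul' c A := by simp

/-- `M ↦ M ⊗ C` as a linear map. -/
def kronRight {V' W' : Type} (C : Matrix W' W' ℂ) :
    Matrix V' V' ℂ →ₗ[ℂ] Matrix (V' × W') (V' × W') ℂ where
  toFun M := M ⊗ₖ C
  map_add' A B := Matrix.add_kronecker A B C
  map_smul' c A := Matrix.smul_kronecker c A C

/-- `M ↦ C ⊗ M` as a linear map. -/
def kronLeft {V' W' : Type} (C : Matrix V' V' ℂ) :
    Matrix W' W' ℂ →ₗ[ℂ] Matrix (V' × W') (V' × W') ℂ where
  toFun M := C ⊗ₖ M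
  map_add' A B := Matrix.kronecker_add C A B
  map_smul' c A := Matrix.kronecker_smul c C A

/-- Reindexing as a linear map. -/
def reindexMap {V' W' : Type} (e : W' → V') : Matrix V' V' ℂ →ₗ[ℂ] Matrix W' W' ℂ where
  toFun M := M.submatrix e e
  map_add' _ _ := rfl
  map_smul' _ _ := rfl

theorem SpaceIso.sum {S : OpSpace V} {S' : OpSpace W} {T : OpSpace X} {T' : OpSpace Y}
    (h : SpaceIso S S') (k : SpaceIso T T') : SpaceIso (sumSpace S T) (sumSpace S' T') := by
  obtain ⟨U, h1, h2, h3, h4⟩ := h.elim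
  obtain ⟨U', k1, k2, k3, k4⟩ := k.elim
  refine SpaceIso.of (Matrix.fromBlocks U 0 0 U') ?_ ?_ ?_ ?_
  · simp [Matrix.fromBlocks_conjTranspose, Matrix.fromBlocks_multiply, h1, k1]
  · simp [Matrix.fromBlocks_conjTranspose, Matrix.fromBlocks_multiply, h2, k2]
  · rintro _ ⟨A, hA, B, hB, rfl⟩
    exact ⟨_, h3 A hA, _, k3 B hB, by
      simp [Matrix.fromBlocks_conjTranspose, Matrix.fromBlocks_multiply]⟩
  · rintro _ ⟨A, hA, B, hB, rfl⟩
    exact ⟨_, h4 A hA, _, k4 B hB, by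
      simp [Matrix.fromBlocks_conjTranspose, Matrix.fromBlocks_multiply]⟩

theorem SpaceIso.tensor {S : OpSpace V} {S' : OpSpace W} {T : OpSpace X} {T' : OpSpace Y}
    (h : SpaceIso S S') (k : SpaceIso T T') :
    SpaceIso (tensorSpace S T) (tensorSpace S' T') := by
  obtain ⟨U, h1, h2, h3, h4⟩ := h.elim
  obtain ⟨U', k1, k2, k3, k4⟩ := k.elim
  refine SpaceIso.of (U ⊗ₖ U') ?_ ?_ ?_ ?_
  · rw [Matrix.conjTranspose_kronecker, ← Matrix.mul_kronecker_mul, h1, k1, Matrix.one_kronecker_one]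
  · rw [Matrix.conjTranspose_kronecker, ← Matrix.mul_kronecker_mul, h2, k2, Matrix.one_kronecker_one]
  · refine tensorSpace_induction (sandwich (U ⊗ₖ U') (U ⊗ₖ U')ᴴ) fun A hA B hB => ?_
    have := kron_mem (h3 A hA) (k3 B hB)
    rwa [Matrix.mul_kronecker_mul, Matrix.mul_kronecker_mul,
      ← Matrix.conjTranspose_kronecker] at this
  · refine tensorSpace_induction (sandwich (U ⊗ₖ U')ᴴ (U ⊗ₖ U')) fun A hA B hB => ?_
    have := kron_mem (h4 A hA) (k4 B hB)
    rwa [Matrix.mul_kronecker_mul, Matrix.mul_kronecker_mul,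
      ← Matrix.conjTranspose_kronecker] at this

theorem spaceIso_sum_comm (S : OpSpace V) (T : OpSpace W) :
    SpaceIso (sumSpace S T) (sumSpace T S) := by
  refine SpaceIso.of_equiv (Equiv.sumComm V W) ?_ ?_ <;> rintro _ ⟨A, hA, B, hB, rfl⟩ <;>
    refine ⟨B, hB, A, hA, ?_⟩ <;> ext (x | x) (y | y) <;> simp

theorem spaceIso_sum_assoc (S : OpSpace V) (T : OpSpace W) (R : OpSpace X) :
    SpaceIso (sumSpace (sumSpace S T) R) (sumSpace S (sumSpace T R)) := by
  refine SpaceIso.of_equiv (Equiv.sumAssoc V W X) ?_ ?_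
  · rintro _ ⟨_, ⟨A, hA, B, hB, rfl⟩, C, hC, rfl⟩
    refine ⟨A, hA, _, ⟨B, hB, C, hC, rfl⟩, ?_⟩
    ext (x | x | x) (y | y | y) <;> simp
  · rintro _ ⟨A, hA, _, ⟨B, hB, C, hC, rfl⟩, rfl⟩
    refine ⟨_, ⟨A, hA, B, hB, rfl⟩, C, hC, ?_⟩
    ext ((x | x) | x) ((y | y) | y) <;> simp

theorem spaceIso_zero_sum (Z : OpSpace Empty) (S : OpSpace V) : SpaceIso (sumSpace Z S) S := by
  refine SpaceIso.of_equiv (Equiv.emptySum Empty V) ?_ ?_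
  · rintro _ ⟨A, hA, B, hB, rfl⟩
    convert hB using 1
    ext x y
    simp [Equiv.emptySum]
  · intro B hB
    refine ⟨0, Z.zero_mem, B, hB, ?_⟩
    ext (x | x) (y | y)
    · exact x.elim
    · exact x.elim
    · exact y.elim
    · simp [Equiv.emptySum]

theorem spaceIso_tensor_comm (S : OpSpace V) (T : OpSpace W) :
    SpaceIso (tensorSpace S T) (tensorSpace T S) := by
  refine SpaceIso.of_equiv (Equiv.prodComm V W) ?_ ?_
  · refine tensorSpace_induction (reindexMap (Equiv.prodComm V W).symm) fun A hA B hB => ?_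
    convert kron_mem hB hA using 1
    ext x y
    exact mul_comm _ _
  · refine tensorSpace_induction (reindexMap (Equiv.prodComm V W)) fun A hA B hB => ?_
    convert kron_mem hB hA using 1
    ext x y
    exact mul_comm _ _

theorem spaceIso_tensor_assoc (S : OpSpace V) (T : OpSpace W) (R : OpSpace X) :
    SpaceIso (tensorSpace (tensorSpace S T) R) (tensorSpace S (tensorSpace T R)) := by
  refine SpaceIso.of_equiv (Equiv.prodAssoc V W X) ?_ ?_
  · refine tensorSpace_induction (reindexMap (Equiv.prodAssoc V W X).symm) fun M hM C hC => ?_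
    refine tensorSpace_induction ((reindexMap (Equiv.prodAssoc V W X).symm).comp
      (kronRight C)) (fun A hA B hB => ?_) M hM
    convert kron_mem hA (kron_mem hB hC) using 1
    ext x y
    exact mul_assoc _ _ _
  · refine tensorSpace_induction (reindexMap (Equiv.prodAssoc V W X)) fun A hA M hM => ?_
    refine tensorSpace_induction ((reindexMap (Equiv.prodAssoc V W X)).comp
      (kronLeft A)) (fun B hB C hC => ?_) M hM
    convert kron_mem (kron_mem hA hB) hC using 1
    ext x y
    exact (mul_assoc _ _ _).symm

theorem spaceIso_one_tensor (S : OpSpace V) :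
    SpaceIso (tensorSpace (Submodule.span ℂ {1} : OpSpace Unit) S) S := by
  refine SpaceIso.of_equiv (Equiv.punitProd V) ?_ ?_
  · refine tensorSpace_induction (reindexMap (Equiv.punitProd V).symm) fun A hA B hB => ?_
    have : reindexMap (Equiv.punitProd V).symm (A ⊗ₖ B) = A () () • B := by
      ext x y
      rfl
    rw [this]
    exact S.smul_mem _ hB
  · intro B hB
    convert kron_mem (Submodule.mem_span_singleton_self (1 : Matrix Unit Unit ℂ)) hB using 1
    ext x y
    simp [Equiv.punitProd]

theorem spaceIso_zero_tensor (Z : OpSpace Empty) (S : OpSpace V) :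
    SpaceIso (tensorSpace Z S) Z := by
  refine SpaceIso.of_equiv (Equiv.equivOfIsEmpty _ _) (fun A hA => ?_) (fun B hB => ?_)
  · rw [Subsingleton.elim (Matrix.submatrix A _ _) 0]
    exact Z.zero_mem
  · rw [Subsingleton.elim (Matrix.submatrix B _ _) 0]
    exact Submodule.zero_mem _

theorem spaceIso_tensor_sum (S : OpSpace V) (T : OpSpace W) (R : OpSpace X) :
    SpaceIso (tensorSpace S (sumSpace T R)) (sumSpace (tensorSpace S T) (tensorSpace S R)) := by
  refine SpaceIso.of_equiv (Equiv.prodSumDistrib V W X) ?_ ?_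
  · refine tensorSpace_induction (reindexMap (Equiv.prodSumDistrib V W X).symm) ?_
    rintro A hA _ ⟨B, hB, C, hC, rfl⟩
    refine ⟨_, kron_mem hA hB, _, kron_mem hA hC, ?_⟩
    ext (x | x) (y | y) <;> simp [reindexMap, Equiv.prodSumDistrib, Equiv.sumProdDistrib]
  · rintro _ ⟨M, hM, N, hN, rfl⟩
    let L : Matrix (V × W) (V × W) ℂ →ₗ[ℂ] Matrix (V × (W ⊕ X)) (V × (W ⊕ X)) ℂ :=
      LinearMap.comp (σ₁₂ := RingHom.id ℂ) (reindexMap (Equiv.prodSumDistrib V W X))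
        { toFun := fun M => Matrix.fromBlocks M 0 0 0
          map_add' := fun a b => by simp [Matrix.fromBlocks_add]
          map_smul' := fun c a => by rw [RingHom.id_apply, Matrix.fromBlocks_smul]; simp }
    let L' : Matrix (V × X) (V × X) ℂ →ₗ[ℂ] Matrix (V × (W ⊕ X)) (V × (W ⊕ X)) ℂ :=
      LinearMap.comp (σ₁₂ := RingHom.id ℂ) (reindexMap (Equiv.prodSumDistrib V W X))
        { toFun := fun M => Matrix.fromBlocks 0 0 0 M
          map_add' := fun a b => by simp [Matrix.fromBlocks_add]
          map_smul' := fun c a => by rw [RingHom.id_apply, Matrix.fromBlocks_smul]; simp }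
    have h1 : L M ∈ tensorSpace S (sumSpace T R) := by
      refine tensorSpace_induction L (fun A hA B hB => ?_) M hM
      convert kron_mem hA (show Matrix.fromBlocks B 0 0 0 ∈ sumSpace T R from
        ⟨B, hB, 0, R.zero_mem, rfl⟩) using 1
      ext ⟨x, (x' | x')⟩ ⟨y, (y' | y')⟩ <;>
        simp [L, reindexMap, Equiv.prodSumDistrib, Equiv.sumProdDistrib]
    have h2 : L' N ∈ tensorSpace S (sumSpace T R) := by
      refine tensorSpace_induction L' (fun A hA B hB => ?_) N hN
      convert kron_mem hA (show Matrix.fromBlocks 0 0 0 B ∈ sumSpace T R from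
        ⟨0, T.zero_mem, B, hB, rfl⟩) using 1
      ext ⟨x, (x' | x')⟩ ⟨y, (y' | y')⟩ <;>
        simp [L', reindexMap, Equiv.prodSumDistrib, Equiv.sumProdDistrib]
    convert Submodule.add_mem _ h1 h2 using 1
    ext ⟨x, (x' | x')⟩ ⟨y, (y' | y')⟩ <;>
      simp [L, L', reindexMap, Equiv.prodSumDistrib, Equiv.sumProdDistrib]

/-! The inclusion of graphs on the level of operator spaces. -/

theorem mem_graphSpace {G : SimpleGraph V} {A : Matrix V V ℂ} :
    A ∈ graphSpace G ↔ ∀ x y, ¬ AdjEq G x y → A x y = 0 := by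
  constructor
  · intro h x y hxy
    induction h using Submodule.span_induction with
    | mem M hM =>
      obtain ⟨a, b, hab, rfl⟩ := hM
      rw [Matrix.single_apply, if_neg]
      rintro ⟨rfl, rfl⟩
      exact hxy hab
    | zero => rfl
    | add M N _ _ hM hN => rw [Matrix.add_apply, hM, hN, add_zero]
    | smul c M _ hM => rw [Matrix.smul_apply, hM, smul_zero]
  · intro h
    rw [Matrix.matrix_eq_sum_single A]
    refine Submodule.sum_mem _ fun x _ => Submodule.sum_mem _ fun y _ => ?_
    by_cases hxy : AdjEq G x y
    · have : Matrix.single x y (A x y) = A x y • Matrix.single x y (1 : ℂ) := by simp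
      rw [this]
      exact Submodule.smul_mem _ _ (Submodule.subset_span ⟨x, y, hxy, rfl⟩)
    · rw [h x y hxy, Matrix.single_zero]
      exact Submodule.zero_mem _

theorem graphSpace_iso {G : SimpleGraph V} {H : SimpleGraph W} (e : G ≃g H) :
    SpaceIso (graphSpace G) (graphSpace H) := by
  refine SpaceIso.of_equiv e.toEquiv (fun A hA => ?_) (fun B hB => ?_)
  · rw [mem_graphSpace] at hA ⊢
    intro x y hxy
    exact hA _ _ fun h => hxy ((adjEq_iso e.symm).1 h)
  · rw [mem_graphSpace] at hB ⊢
    intro x y hxy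
    exact hB _ _ fun h => hxy ((adjEq_iso e).1 h)

theorem graphSpace_sum (G : SimpleGraph V) (H : SimpleGraph W) :
    graphSpace (G ⊕g H) = sumSpace (graphSpace G) (graphSpace H) := by
  ext M
  rw [mem_graphSpace]
  constructor
  · intro h
    refine ⟨M.toBlocks₁₁, ?_, M.toBlocks₂₂, ?_, ?_⟩
    · exact mem_graphSpace.2 fun x y hxy => h _ _ fun k => hxy (adjEq_sum_inl.1 k)
    · exact mem_graphSpace.2 fun x y hxy => h _ _ fun k => hxy (adjEq_sum_inr.1 k)
    · ext (x | x) (y | y)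
      · rfl
      · exact h _ _ adjEq_sum_inl_inr.1
      · exact h _ _ adjEq_sum_inr_inl.1
      · rfl
  · rintro ⟨A, hA, B, hB, rfl⟩ (x | x) (y | y) hxy
    · exact mem_graphSpace.1 hA x y fun k => hxy (adjEq_sum_inl.2 k)
    · rfl
    · rfl
    · exact mem_graphSpace.1 hB x y fun k => hxy (adjEq_sum_inr.2 k)

theorem graphSpace_strong (G : SimpleGraph V) (H : SimpleGraph W) :
    graphSpace (strongProd G H) = tensorSpace (graphSpace G) (graphSpace H) := by
  refine le_antisymm (Submodule.span_le.2 ?_) (Submodule.span_le.2 ?_)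
  · rintro _ ⟨⟨x, x'⟩, ⟨y, y'⟩, h, rfl⟩
    have h' := adjEq_strongProd.1 h
    have := kron_mem (S := graphSpace G) (T := graphSpace H)
      (Submodule.subset_span ⟨x, y, h'.1, rfl⟩) (Submodule.subset_span ⟨x', y', h'.2, rfl⟩)
    rwa [Matrix.single_kronecker_single, mul_one] at this
  · rintro _ ⟨A, hA, B, hB, rfl⟩
    refine mem_graphSpace.2 fun p q hpq => ?_
    rw [Matrix.kroneckerMap_apply]
    by_cases h : AdjEq G p.1 q.1
    · rw [mem_graphSpace.1 hB _ _ fun k => hpq (adjEq_strongProd.2 ⟨h, k⟩), mul_zero]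
    · rw [mem_graphSpace.1 hA _ _ h, zero_mul]

theorem graphSpace_unit : graphSpace (⊥ : SimpleGraph Unit) = Submodule.span ℂ {1} := by
  ext A
  refine ⟨fun _ => ?_, fun _ => mem_graphSpace.2 fun x y h => (h (Or.inl rfl)).elim⟩
  refine Submodule.mem_span_singleton.2 ⟨A () (), ?_⟩
  ext
  simp

end Spaces

/-! ## Noncommutative graphs -/

/-- A noncommutative graph: a subspace `S` of the operators on `ℂ^V` with `1 ∈ S` and `S* = S`. -/
structure NCGraph where
  V : Type
  [fintypeV : Fintype V]
  [decEqV : DecidableEq V]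
  space : OpSpace V
  one_mem : 1 ∈ space
  star_mem : ∀ A ∈ space, Aᴴ ∈ space

attribute [instance] NCGraph.fintypeV NCGraph.decEqV

namespace NCGraph

instance setoid : Setoid NCGraph where
  r S T := SpaceIso S.space T.space
  iseqv := ⟨fun S => SpaceIso.refl S.space, SpaceIso.symm, SpaceIso.trans⟩

/-- Direct sum. -/
def directSum (S T : NCGraph) : NCGraph where
  V := S.V ⊕ T.V
  space := sumSpace S.space T.space
  one_mem := ⟨1, S.one_mem, 1, T.one_mem, Matrix.fromBlocks_one.symm⟩
  star_mem := by
    rintro _ ⟨A, hA, B, hB, rfl⟩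
    exact ⟨Aᴴ, S.star_mem A hA, Bᴴ, T.star_mem B hB, by simp [Matrix.fromBlocks_conjTranspose]⟩

/-- Tensor product. -/
def tensor (S T : NCGraph) : NCGraph where
  V := S.V × T.V
  space := tensorSpace S.space T.space
  one_mem := by
    have := kron_mem S.one_mem T.one_mem
    rwa [Matrix.one_kronecker_one] at this
  star_mem := by
    intro M hM
    induction hM using Submodule.span_induction with
    | mem M hM =>
      obtain ⟨A, hA, B, hB, rfl⟩ := hM
      rw [Matrix.conjTranspose_kronecker]
      exact kron_mem (S.star_mem A hA) (T.star_mem B hB)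
    | zero => rw [Matrix.conjTranspose_zero]; exact Submodule.zero_mem _
    | add M N _ _ hM hN => rw [Matrix.conjTranspose_add]; exact Submodule.add_mem _ hM hN
    | smul c M _ hM => rw [Matrix.conjTranspose_smul]; exact Submodule.smul_mem _ _ hM

/-- The confusability graph `ℂ I` of the identity channel on the operators on `ℂ^V`. -/
def scalars (V : Type) [Fintype V] [DecidableEq V] : NCGraph where
  V := V
  space := Submodule.span ℂ {1}
  one_mem := Submodule.mem_span_singleton_self _
  star_mem := by
    intro M hM
    obtain ⟨c, rfl⟩ := Submodule.mem_span_singleton.1 hM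
    rw [Matrix.conjTranspose_smul, Matrix.conjTranspose_one]
    exact Submodule.smul_mem _ _ (Submodule.mem_span_singleton_self _)

/-- The noncommutative graph of a graph. -/
def ofGraph (G : FinGraph) : NCGraph where
  V := G.V
  space := graphSpace G.graph
  one_mem := mem_graphSpace.2 fun _ _ h => Matrix.one_apply_ne fun k => h (Or.inl k)
  star_mem := by
    intro A hA
    refine mem_graphSpace.2 fun x y h => ?_
    rw [Matrix.conjTranspose_apply, mem_graphSpace.1 hA y x fun k => h k.symm, star_zero]

end NCGraph

/-- The set `𝒢_nc` of isomorphism classes of noncommutative graphs. -/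
def NCGraphClass : Type 1 := Quotient NCGraph.setoid

namespace NCGraphClass

instance : Zero NCGraphClass := ⟨Quotient.mk _ (NCGraph.scalars Empty)⟩
instance : One NCGraphClass := ⟨Quotient.mk _ (NCGraph.scalars Unit)⟩
instance : Add NCGraphClass :=
  ⟨Quotient.map₂ NCGraph.directSum fun _ _ h _ _ h' => SpaceIso.sum h h'⟩
instance : Mul NCGraphClass :=
  ⟨Quotient.map₂ NCGraph.tensor fun _ _ h _ _ h' => SpaceIso.tensor h h'⟩

protected theorem add_comm' (a b : NCGraphClass) : a + b = b + a := by
  induction a using Quotient.inductionOn with | _ S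
  induction b using Quotient.inductionOn with | _ T
  exact Quotient.sound (spaceIso_sum_comm S.space T.space)

protected theorem zero_add' (a : NCGraphClass) : 0 + a = a := by
  induction a using Quotient.inductionOn with | _ S
  exact Quotient.sound (spaceIso_zero_sum _ S.space)

protected theorem mul_comm' (a b : NCGraphClass) : a * b = b * a := by
  induction a using Quotient.inductionOn with | _ S
  induction b using Quotient.inductionOn with | _ T
  exact Quotient.sound (spaceIso_tensor_comm S.space T.space)

protected theorem one_mul' (a : NCGraphClass) : 1 * a = a := by
  induction a using Quotient.inductionOn with | _ S
  exact Quotient.sound (spaceIso_one_tensor S.space)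

protected theorem zero_mul' (a : NCGraphClass) : 0 * a = 0 := by
  induction a using Quotient.inductionOn with | _ S
  exact Quotient.sound (spaceIso_zero_tensor _ S.space)

protected theorem left_distrib' (a b c : NCGraphClass) : a * (b + c) = a * b + a * c := by
  induction a using Quotient.inductionOn with | _ S
  induction b using Quotient.inductionOn with | _ T
  induction c using Quotient.inductionOn with | _ R
  exact Quotient.sound (spaceIso_tensor_sum S.space T.space R.space)

/-- The semiring of noncommutative graphs: direct sum as addition, tensor product as
multiplication. -/
instance : CommSemiring NCGraphClass where
  add_assoc a b c := by
    induction a using Quotient.inductionOn with | _ S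
    induction b using Quotient.inductionOn with | _ T
    induction c using Quotient.inductionOn with | _ R
    exact Quotient.sound (spaceIso_sum_assoc S.space T.space R.space)
  zero_add := NCGraphClass.zero_add'
  add_zero a := (NCGraphClass.add_comm' a 0).trans (NCGraphClass.zero_add' a)
  add_comm := NCGraphClass.add_comm'
  nsmul := nsmulRec
  mul_assoc a b c := by
    induction a using Quotient.inductionOn with | _ S
    induction b using Quotient.inductionOn with | _ T
    induction c using Quotient.inductionOn with | _ R
    exact Quotient.sound (spaceIso_tensor_assoc S.space T.space R.space)
  one_mul := NCGraphClass.one_mul'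
  mul_one a := (NCGraphClass.mul_comm' a 1).trans (NCGraphClass.one_mul' a)
  left_distrib := NCGraphClass.left_distrib'
  right_distrib a b c := by
    rw [NCGraphClass.mul_comm', NCGraphClass.left_distrib', NCGraphClass.mul_comm' c a,
      NCGraphClass.mul_comm' c b]
  zero_mul := NCGraphClass.zero_mul'
  mul_zero a := (NCGraphClass.mul_comm' a 0).trans (NCGraphClass.zero_mul' a)
  mul_comm := NCGraphClass.mul_comm'

/-- The cohomomorphism preorder on noncommutative graphs. -/
instance : Preorder NCGraphClass where
  le := Quotient.lift₂ (fun T S : NCGraph => SpaceCohom T.space S.space) fun _ _ _ _ h h' => propext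
    ⟨fun k => (SpaceIso.symm h).cohom.trans (k.trans (SpaceIso.cohom h')),
      fun k => (SpaceIso.cohom h).trans (k.trans (SpaceIso.symm h').cohom)⟩
  le_refl a := by
    induction a using Quotient.inductionOn with | _ S
    exact (SpaceIso.refl S.space).cohom
  le_trans a b c := by
    induction a using Quotient.inductionOn with | _ S
    induction b using Quotient.inductionOn with | _ T
    induction c using Quotient.inductionOn with | _ R
    exact SpaceCohom.trans

/-- The noiseless quantum channel of dimension `d`. -/
def idealQuantum (d : ℕ) : NCGraphClass := Quotient.mk _ (NCGraph.scalars (Fin d))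

/-- The inclusion `𝒢 → 𝒢_nc`. -/
def ofGraph : GraphClass →+* NCGraphClass where
  toFun := Quotient.map NCGraph.ofGraph fun _ _ h => h.elim fun e => graphSpace_iso e
  map_zero' := Quotient.sound (by
    change SpaceIso (graphSpace (⊥ : SimpleGraph Empty)) (Submodule.span ℂ {1})
    rw [Subsingleton.elim (graphSpace (⊥ : SimpleGraph Empty)) (Submodule.span ℂ {1})]
    exact SpaceIso.refl _)
  map_one' := Quotient.sound (by
    change SpaceIso (graphSpace (⊥ : SimpleGraph Unit)) (Submodule.span ℂ {1})
    rw [graphSpace_unit]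
    exact SpaceIso.refl _)
  map_add' a b := by
    induction a using Quotient.inductionOn with | _ G
    induction b using Quotient.inductionOn with | _ H
    refine Quotient.sound ?_
    change SpaceIso (graphSpace (G.graph ⊕g H.graph))
      (sumSpace (graphSpace G.graph) (graphSpace H.graph))
    rw [graphSpace_sum]
    exact SpaceIso.refl _
  map_mul' a b := by
    induction a using Quotient.inductionOn with | _ G
    induction b using Quotient.inductionOn with | _ H
    refine Quotient.sound ?_
    change SpaceIso (graphSpace (strongProd G.graph H.graph))
      (tensorSpace (graphSpace G.graph) (graphSpace H.graph))
    rw [graphSpace_strong]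
    exact SpaceIso.refl _

end NCGraphClass

/-! ## The semiring `𝒜`, asymptotic spectra and admissible exponents -/

/-- The subsemiring `𝒜` of `𝒢_nc` generated by all graphs and all noiseless quantum channels, with
the restricted operations and preorder. -/
def semiringA : Subsemiring NCGraphClass :=
  Subsemiring.closure (Set.range NCGraphClass.ofGraph ∪ Set.range NCGraphClass.idealQuantum)

/-- The inclusion `𝒢 → 𝒜`. -/
def graphA : GraphClass →+* semiringA :=
  NCGraphClass.ofGraph.codRestrict semiringA
    fun G => Subsemiring.subset_closure (Or.inl ⟨G, rfl⟩)

/-- The noiseless quantum channel of dimension `d` as an element of `𝒜`. -/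
def idealQuantumA (d : ℕ) : semiringA :=
  ⟨NCGraphClass.idealQuantum d, Subsemiring.subset_closure (Or.inr ⟨d, rfl⟩)⟩

/-- The asymptotic spectrum `Δ(S, ≤)`: the monotone semiring homomorphisms `S → ℝ≥0`. -/
def asymptoticSpectrum (S : Type*) [CommSemiring S] [Preorder S] : Set (S →+* ℝ≥0) :=
  {f | Monotone f}

/-- `α ≥ 1` is an admissible exponent for the graph parameter `f` if
`⨁_{d = 1}^r G_d ⊗ (ideal quantum channel of dimension d) ↦ ∑_{d = 1}^r f(G_d) d^α` defines an
element of `Δ(𝒜, ≤)`. -/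
def IsAdmissibleExponent (f : GraphClass → ℝ) (α : ℝ) : Prop :=
  1 ≤ α ∧ ∃ F ∈ asymptoticSpectrum semiringA, ∀ (r : ℕ) (G : ℕ → GraphClass),
    (F (∑ d ∈ Finset.Icc 1 r, graphA (G d) * idealQuantumA d) : ℝ) =
      ∑ d ∈ Finset.Icc 1 r, f (G d) * (d : ℝ) ^ α

end

/-!
A monotone multiplicative map `F` on `𝒜` grows only polynomially along the noiseless channels, since
`F 𝒬_d` is monotone and multiplicative in `d`. A graph whose nonadjacent vertices can be represented
by orthogonal nonzero vectors of `ℂ^d` is bounded by `𝒬_d`. So if `F` dominated the fractional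
clique cover number, that number would be polynomially bounded in the dimension of such a
representation.

Sign vectors of length `4 p`, for an odd prime `p`, violate this. If `2 ^ (4 p - 2)` of them are
chosen so that all inner products are divisible by `4` and no two are antipodal, then an inner
product of two distinct ones vanishes modulo `p` only when it vanishes. The polynomial method of
Frankl and Wilson therefore bounds a set of pairwise nonorthogonal vectors by a binomial
coefficient, roughly `(3125 / 256) ^ p`, and the fractional clique cover number is at least of order
`(4096 / 3125) ^ p`.
-/

theorem exists_mul_eq_dotProduct_pow {R ι J L : Type*} [CommSemiring R] [Fintype ι]
    [DecidableEq ι] (v : J → ι → R) (w : L → ι → R) (k : ℕ) :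
    ∃ (A : Matrix J (Sym ι k) R) (B : Matrix (Sym ι k) L R),
      A * B = Matrix.of fun i j => (v i ⬝ᵥ w j) ^ k := by
  refine ⟨.of fun i s => s.val.countPerms * (s.val.map (v i)).prod,
    .of fun s j => (s.val.map (w j)).prod, ?_⟩
  ext i j
  simp only [Matrix.mul_apply, Matrix.of_apply, dotProduct]
  rw [Finset.sum_pow]
  simp [Multiset.prod_map_mul, mul_assoc]

theorem card_le_multichoose_add_one_of_dotProduct_ne_zero {F ι J : Type*} [Field F]
    [Fintype F] [Fintype ι] [Fintype J] (v : J → ι → F) (hself : ∀ i, v i ⬝ᵥ v i = 0)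
    (hne : ∀ i j, i ≠ j → v i ⬝ᵥ v j ≠ 0) :
    Fintype.card J ≤ (Fintype.card ι).multichoose (Fintype.card F - 1) + 1 := by
  classical
  have hq : Fintype.card F - 1 ≠ 0 := Nat.sub_ne_zero_of_lt Fintype.one_lt_card
  obtain ⟨A, B, hAB⟩ := exists_mul_eq_dotProduct_pow v v (Fintype.card F - 1)
  -- By Fermat, subtracting the matrix of `(q - 1)`-st powers from the all-ones matrix leaves `1`.
  have hone : Matrix.fromCols (-A) (.of fun _ _ => 1 : Matrix J Unit F) *
      Matrix.fromRows B (.of fun _ _ => 1 : Matrix Unit J F) = 1 := by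
    rw [Matrix.fromCols_mul_fromRows, Matrix.neg_mul, hAB]
    ext i j
    rcases eq_or_ne i j with rfl | hij
    · simp [Matrix.mul_apply, hself, hq]
    · simp [Matrix.mul_apply, FiniteField.pow_card_sub_one_eq_one _ (hne i j hij), hij]
  calc Fintype.card J = (1 : Matrix J J F).rank := Matrix.rank_one.symm
    _ ≤ Fintype.card (Sym ι (Fintype.card F - 1) ⊕ Unit) := by
      rw [← hone]
      exact (Matrix.rank_mul_le_left _ _).trans (Matrix.rank_le_card_width _)
    _ = (Fintype.card ι).multichoose (Fintype.card F - 1) + 1 := by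
      rw [Fintype.card_sum, Sym.card_sym_eq_multichoose, Fintype.card_unit]

theorem choose_mul_pow_mul_pow_le {R : Type*} [CommSemiring R] [PartialOrder R] [IsOrderedRing R]
    {a b : R} (ha : 0 ≤ a) (hb : 0 ≤ b) (m n : ℕ) :
    a ^ m * b ^ n * (m + n).choose m ≤ (a + b) ^ (m + n) := by
  rw [add_pow]
  refine (Finset.single_le_sum
    (f := fun i => a ^ i * b ^ (m + n - i) * ((m + n).choose i : R)) (fun i _ => by positivity)
    (Finset.mem_range.2 (by omega : m < m + n + 1))).trans_eq' ?_
  rw [Nat.add_sub_cancel_left]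

theorem multichoose_lt_multichoose_succ {n : ℕ} (hn : 2 ≤ n) (k : ℕ) :
    n.multichoose k < n.multichoose (k + 1) := by
  obtain ⟨l, rfl⟩ := Nat.exists_eq_add_of_le' hn
  have hpos : 0 < (l + 1).multichoose (k + 1) := by
    rw [Nat.multichoose_eq]
    exact Nat.choose_pos (by omega)
  exact (Nat.multichoose_succ_succ (l + 1) k).symm ▸ Nat.lt_add_of_pos_left hpos

theorem multichoose_le_choose (n k : ℕ) : n.multichoose k ≤ (n + k).choose n := by
  rw [Nat.multichoose_eq, Nat.choose_symm_add]
  exact Nat.choose_le_choose k (Nat.sub_le _ _)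

theorem multichoose_four_mul_add_one_mul_pow_le {p : ℕ} (hp : p ≠ 0) :
    ((4 * p).multichoose (p - 1) + 1) * 256 ^ p ≤ 3125 ^ p := by
  obtain ⟨k, rfl⟩ := Nat.exists_eq_succ_of_ne_zero hp
  calc _ ≤ (4 * (k + 1) + (k + 1)).choose (4 * (k + 1)) * 256 ^ (k + 1) :=
        Nat.mul_le_mul_right _ ((multichoose_lt_multichoose_succ (by omega) k).trans_le
          (multichoose_le_choose _ _))
    _ = 4 ^ (4 * (k + 1)) * 1 ^ (k + 1) * (4 * (k + 1) + (k + 1)).choose (4 * (k + 1)) := by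
      rw [pow_mul, one_pow, mul_one, mul_comm]; norm_num
    _ ≤ (4 + 1) ^ (4 * (k + 1) + (k + 1)) := by
      exact_mod_cast choose_mul_pow_mul_pow_le (R := ℕ) (Nat.zero_le 4) (Nat.zero_le 1) _ _
    _ = 3125 ^ (k + 1) := by
      rw [← Nat.succ_mul, pow_mul]; norm_num

theorem exists_forall_map_le_two_mul_pow {R : Type*} [Semiring R] [LinearOrder R]
    [IsStrictOrderedRing R] [ExistsAddOfLE R] [Archimedean R] {f : ℕ →* R} (hf : Monotone f) :
    ∃ a : ℕ, ∀ n ≠ 0, f n ≤ (2 * n) ^ a := by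
  obtain ⟨a, ha⟩ := pow_unbounded_of_one_lt (f 2) (one_lt_two : (1 : R) < 2)
  have hf2 : 0 ≤ f 2 := zero_le_one.trans (f.map_one ▸ hf one_le_two)
  refine ⟨a, fun n hn => ?_⟩
  set k := Nat.log 2 n + 1
  have hk : 2 ^ k ≤ 2 * n := by
    rw [pow_succ']
    exact Nat.mul_le_mul_left 2 (Nat.pow_log_le_self 2 hn)
  calc f n ≤ f (2 ^ k) := hf (Nat.lt_pow_succ_log_self one_lt_two n).le
    _ = f 2 ^ k := map_pow f 2 k
    _ ≤ (2 ^ a) ^ k := pow_le_pow_left₀ hf2 ha.le k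
    _ = (2 ^ k) ^ a := pow_right_comm 2 a k
    _ ≤ (2 * n) ^ a := pow_le_pow_left₀ (by positivity) (by exact_mod_cast hk) a

theorem eventually_const_mul_pow_mul_pow_lt {r s : ℝ} (hrs : |r| < s) (C : ℝ) (k : ℕ) :
    ∀ᶠ n : ℕ in Filter.atTop, C * (n ^ k * r ^ n) < s ^ n := by
  filter_upwards [((isLittleO_pow_const_mul_const_pow_const_pow_of_norm_lt k hrs).const_mul_left
    C).def one_half_pos] with n hn
  have hs : 0 < s ^ n := pow_pos ((abs_nonneg r).trans_lt hrs) n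
  rw [Real.norm_of_nonneg hs.le] at hn
  linarith [le_abs_self (C * (n ^ k * r ^ n)), Real.norm_eq_abs (C * (n ^ k * r ^ n))]

theorem fractionalColoringValues_nonempty {V : Type} [Fintype V] [DecidableEq V]
    (G : SimpleGraph V) : (fractionalColoringValues G).Nonempty := by
  refine ⟨_, fun I => if I.card = 1 then 1 else 0, fun I => ?_, fun I hI => ?_, fun v => ?_, rfl⟩
  · dsimp only
    split_ifs <;> simp
  · obtain ⟨x, rfl⟩ := Finset.card_eq_one.1 (by simpa using hI)
    simp
  · refine le_trans (by simp) (Finset.single_le_sum (f := fun I : Finset V =>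
      if v ∈ I then if I.card = 1 then (1 : ℝ) else 0 else 0) (fun I _ => ?_)
      (Finset.mem_univ {v}))
    split_ifs <;> simp

theorem card_le_indepNum_mul_of_mem_fractionalColoringValues {V : Type} [Fintype V] [DecidableEq V]
    {G : SimpleGraph V} {t : ℝ} (ht : t ∈ fractionalColoringValues G) :
    (Fintype.card V : ℝ) ≤ G.indepNum * t := by
  obtain ⟨w, hw_nonneg, hw_indep, hw_cover, rfl⟩ := ht
  have card_mul_le (I : Finset V) : I.card * w I ≤ G.indepNum * w I := by
    rcases eq_or_ne (w I) 0 with hI | hI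
    · rw [hI, mul_zero, mul_zero]
    · exact mul_le_mul_of_nonneg_right
        (Nat.cast_le.2 (hw_indep I hI).card_le_indepNum) (hw_nonneg I)
  calc (Fintype.card V : ℝ) = ∑ _v : V, 1 := by simp
    _ ≤ ∑ v : V, ∑ I : Finset V, if v ∈ I then w I else 0 :=
      Finset.sum_le_sum fun v _ => hw_cover v
    _ = ∑ I : Finset V, I.card * w I := by
      rw [Finset.sum_comm]
      simp
    _ ≤ ∑ I : Finset V, G.indepNum * w I := Finset.sum_le_sum fun I _ => card_mul_le I
    _ = G.indepNum * ∑ I : Finset V, w I := by rw [Finset.mul_sum]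

theorem card_le_indepNum_mul_fractionalChromaticNumber {V : Type} [Fintype V] [DecidableEq V]
    (G : SimpleGraph V) : (Fintype.card V : ℝ) ≤ G.indepNum * fractionalChromaticNumber G := by
  rw [fractionalChromaticNumber, ← smul_eq_mul, ← Real.sInf_smul_of_nonneg (Nat.cast_nonneg _)]
  refine le_csInf (fractionalColoringValues_nonempty G).smul_set ?_
  rintro _ ⟨t, ht, rfl⟩
  exact card_le_indepNum_mul_of_mem_fractionalColoringValues ht

theorem card_le_cliqueNum_mul_fractionalCliqueCover (G : FinGraph) :
    (Fintype.card G.V : ℝ) ≤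
      G.graph.cliqueNum * fractionalCliqueCover (Quotient.mk _ G) :=
  SimpleGraph.indepNum_compl (G := G.graph) ▸
    card_le_indepNum_mul_fractionalChromaticNumber G.graphᶜ

/-- The graph in which two distinct points are adjacent when the vectors attached to them are not
orthogonal; its complement is the graph for which `v` is an orthogonal representation. -/
def nonorthogonalityGraph {V ι R : Type*} [Fintype ι] [CommSemiring R] (v : V → ι → R) :
    SimpleGraph V where
  Adj x y := x ≠ y ∧ v x ⬝ᵥ v y ≠ 0
  symm := ⟨fun _ _ h => ⟨h.1.symm, dotProduct_comm (v _) (v _) ▸ h.2⟩⟩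
  loopless := ⟨fun _ h => h.1 rfl⟩

theorem cliqueNum_nonorthogonalityGraph_le {V ι : Type*} [Finite V] [Fintype ι] {p : ℕ}
    [Fact p.Prime] {v : V → ι → ℤ} (hself : ∀ x, (p : ℤ) ∣ v x ⬝ᵥ v x)
    (hne : ∀ x y, x ≠ y → (p : ℤ) ∣ v x ⬝ᵥ v y → v x ⬝ᵥ v y = 0) :
    (nonorthogonalityGraph v).cliqueNum ≤ (Fintype.card ι).multichoose (p - 1) + 1 := by
  cases nonempty_fintype V
  obtain ⟨s, hs⟩ := (nonorthogonalityGraph v).exists_isNClique_cliqueNum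
  have dotProduct_eq_zero_iff (x y : V) :
      (Int.castRingHom (ZMod p) ∘ v x) ⬝ᵥ (Int.castRingHom (ZMod p) ∘ v y) = 0 ↔
        (p : ℤ) ∣ v x ⬝ᵥ v y := by
    rw [← RingHom.map_dotProduct, eq_intCast, ZMod.intCast_zmod_eq_zero_iff_dvd]
  have hcard := card_le_multichoose_add_one_of_dotProduct_ne_zero
    (fun x : s => Int.castRingHom (ZMod p) ∘ v x)
    (fun x => (dotProduct_eq_zero_iff x x).2 (hself x))
    fun x y hxy h => by
      have hxy : (x : V) ≠ y := Subtype.coe_ne_coe.2 hxy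
      exact (hs.isClique x.2 y.2 hxy).2 (hne x y hxy ((dotProduct_eq_zero_iff x y).1 h))
  rwa [Fintype.card_coe, hs.card_eq, ZMod.card] at hcard

/-- The sign vector `x` preceded by the entries `1` and `∏ i, x i`. The product makes all inner
products of such vectors congruent modulo `4`, and the entry `1` prevents two of them from being
antipodal. -/
def signExtension {m : ℕ} (x : Fin m → ℤˣ) : Fin (m + 2) → ℤ :=
  Matrix.vecCons 1 (Matrix.vecCons ((∏ i, x i : ℤˣ) : ℤ) fun i => (x i : ℤ))

theorem signExtension_dotProduct {m : ℕ} (x y : Fin m → ℤˣ) :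
    signExtension x ⬝ᵥ signExtension y =
      1 + ((∏ i, (x * y) i : ℤˣ) : ℤ) + ∑ i, (((x * y) i : ℤˣ) : ℤ) := by
  rw [signExtension, signExtension, Matrix.cons_dotProduct_cons, Matrix.cons_dotProduct_cons]
  simp [Finset.prod_mul_distrib, add_assoc, dotProduct]

theorem signExtension_dotProduct_self {m : ℕ} (x : Fin m → ℤˣ) :
    signExtension x ⬝ᵥ signExtension x = m + 2 := by
  simp only [signExtension_dotProduct, Pi.mul_apply, Int.units_mul_self, Finset.prod_const_one,
    Units.val_one, Finset.sum_const, Finset.card_univ, Fintype.card_fin, nsmul_one]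
  ring

theorem intUnits_modEq_one (u : ℤˣ) : (u : ℤ) ≡ 1 [ZMOD 2] := by
  rcases Int.units_eq_one_or u with rfl | rfl <;> decide

theorem intUnits_le_one (u : ℤˣ) : (u : ℤ) ≤ 1 := by
  rcases Int.units_eq_one_or u with rfl | rfl <;> decide

theorem neg_one_le_intUnits (u : ℤˣ) : -1 ≤ (u : ℤ) := by
  rcases Int.units_eq_one_or u with rfl | rfl <;> decide

theorem intUnits_mul_modEq (u v : ℤˣ) : ((u * v : ℤˣ) : ℤ) ≡ u + v - 1 [ZMOD 4] := by
  rcases Int.units_eq_one_or u with rfl | rfl <;> rcases Int.units_eq_one_or v with rfl | rfl <;>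
    decide

theorem intUnits_prod_modEq {α : Type*} (s : Finset α) (z : α → ℤˣ) :
    ((∏ i ∈ s, z i : ℤˣ) : ℤ) ≡ 1 + ∑ i ∈ s, ((z i : ℤ) - 1) [ZMOD 4] := by
  classical
  induction s using Finset.induction_on with
  | empty => rfl
  | insert a s ha ih =>
    rw [Finset.prod_insert ha, Finset.sum_insert ha]
    calc _ ≡ z a + (∏ i ∈ s, z i : ℤˣ) - 1 [ZMOD 4] := intUnits_mul_modEq _ _
      _ ≡ z a + (1 + ∑ i ∈ s, ((z i : ℤ) - 1)) - 1 [ZMOD 4] := (ih.add_left _).sub_right _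
      _ = 1 + (((z a : ℤ) - 1) + ∑ i ∈ s, ((z i : ℤ) - 1)) := by ring

theorem four_dvd_signExtension_dotProduct {m : ℕ} (hm : 4 ∣ m + 2) (x y : Fin m → ℤˣ) :
    4 ∣ signExtension x ⬝ᵥ signExtension y := by
  have hprod := intUnits_prod_modEq Finset.univ (x * y)
  have hsum : 2 ∣ ∑ i, (((x * y) i : ℤ) - 1) :=
    Finset.dvd_sum fun i _ => (intUnits_modEq_one ((x * y) i)).symm.dvd
  have hsplit : ∑ i, ((x * y) i : ℤ) = ∑ i, (((x * y) i : ℤ) - 1) + m := by simp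
  rw [signExtension_dotProduct, hsplit]
  rw [Int.modEq_iff_dvd] at hprod
  omega

theorem abs_signExtension_dotProduct_lt {m : ℕ} {x y : Fin m → ℤˣ} (hxy : x ≠ y) :
    |signExtension x ⬝ᵥ signExtension y| < m + 2 := by
  have hsum_ge : -(m : ℤ) ≤ ∑ i, (((x * y) i : ℤˣ) : ℤ) := by
    simpa using Finset.sum_le_sum fun i (_ : i ∈ Finset.univ) => neg_one_le_intUnits ((x * y) i)
  have hsum_lt : ∑ i, (((x * y) i : ℤˣ) : ℤ) < m := by
    obtain ⟨i, hi⟩ := Function.ne_iff.1 hxy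
    have hi_ne : (x * y) i ≠ 1 := by
      rwa [Ne, Pi.mul_apply, mul_eq_one_iff_eq_inv, Int.units_inv_eq_self]
    have hi_lt : (((x * y) i : ℤˣ) : ℤ) < 1 :=
      (intUnits_le_one _).lt_of_ne (mt Units.val_eq_one.1 hi_ne)
    simpa using Finset.sum_lt_sum (fun i (_ : i ∈ Finset.univ) => intUnits_le_one ((x * y) i))
      ⟨i, Finset.mem_univ i, hi_lt⟩
  have hprod_ge := neg_one_le_intUnits (∏ i, (x * y) i)
  have hprod_le := intUnits_le_one (∏ i, (x * y) i)
  rw [signExtension_dotProduct, abs_lt]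
  constructor <;> linarith

/-- The nonorthogonality graph of the `2 ^ m` extended sign vectors. -/
def signGraph (m : ℕ) : FinGraph where
  V := Fin m → ℤˣ
  graph := nonorthogonalityGraph signExtension

theorem card_signGraph (m : ℕ) : Fintype.card (signGraph m).V = 2 ^ m := by
  change Fintype.card (Fin m → ℤˣ) = _
  simp

theorem signExtension_dotProduct_eq_zero_of_dvd {m p : ℕ} (hp : Odd p) (hm : m + 2 = 4 * p)
    {x y : Fin m → ℤˣ} (hxy : x ≠ y) (hdvd : (p : ℤ) ∣ signExtension x ⬝ᵥ signExtension y) :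
    signExtension x ⬝ᵥ signExtension y = 0 := by
  have hcoprime : IsCoprime (4 : ℤ) p := by
    exact_mod_cast Nat.isCoprime_iff_coprime.2 (Nat.Coprime.pow_left 2 hp.coprime_two_left)
  refine Int.eq_zero_of_abs_lt_dvd
    (hcoprime.mul_dvd (four_dvd_signExtension_dotProduct ⟨p, hm⟩ x y) hdvd) ?_
  have hm_cast : (m : ℤ) + 2 = 4 * p := mod_cast hm
  exact hm_cast ▸ abs_signExtension_dotProduct_lt hxy

theorem cliqueNum_signGraph_le {m p : ℕ} (hp : p.Prime) (hp_odd : Odd p) (hm : m + 2 = 4 * p) :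
    (signGraph m).graph.cliqueNum ≤ (4 * p).multichoose (p - 1) + 1 := by
  have : Fact p.Prime := ⟨hp⟩
  rw [← hm, ← Fintype.card_fin (m + 2)]
  refine cliqueNum_nonorthogonalityGraph_le (v := signExtension (m := m)) (fun x => ?_)
    fun x y hxy => signExtension_dotProduct_eq_zero_of_dvd hp_odd hm hxy
  rw [signExtension_dotProduct_self]
  exact_mod_cast hm ▸ dvd_mul_left p 4

theorem pow_le_mul_fractionalCliqueCover_signGraph {m p : ℕ} (hp : p.Prime) (hp_odd : Odd p)
    (hm : m + 2 = 4 * p) :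
    (4096 : ℝ) ^ p ≤ 4 * 3125 ^ p * fractionalCliqueCover (Quotient.mk _ (signGraph m)) := by
  set χ := fractionalCliqueCover (Quotient.mk _ (signGraph m))
  have hcard : (2 : ℝ) ^ m ≤ (signGraph m).graph.cliqueNum * χ := by
    exact_mod_cast card_signGraph m ▸ card_le_cliqueNum_mul_fractionalCliqueCover (signGraph m)
  have hχ : 0 ≤ χ :=
    (pos_of_mul_pos_right ((pow_pos two_pos m).trans_le hcard) (Nat.cast_nonneg _)).le
  have hnum : ((signGraph m).graph.cliqueNum : ℝ) * 256 ^ p ≤ 3125 ^ p := by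
    exact_mod_cast (Nat.mul_le_mul_right _ (cliqueNum_signGraph_le hp hp_odd hm)).trans
      (multichoose_four_mul_add_one_mul_pow_le hp.ne_zero)
  calc (4096 : ℝ) ^ p = 4 * 256 ^ p * 2 ^ m := by
        have hpow : (4 : ℝ) * 2 ^ m = 16 ^ p := by
          rw [(by norm_num : (4 : ℝ) = 2 ^ 2), ← pow_add, add_comm, hm, pow_mul]
          norm_num
        rw [mul_right_comm, hpow, ← mul_pow]
        norm_num
    _ ≤ 4 * 256 ^ p * ((signGraph m).graph.cliqueNum * χ) := by gcongr
    _ = 4 * ((signGraph m).graph.cliqueNum * 256 ^ p) * χ := by ring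
    _ ≤ 4 * 3125 ^ p * χ := by gcongr

theorem tensorSpace_scalars {V W : Type} [DecidableEq V] [DecidableEq W] :
    tensorSpace (ℂ ∙ (1 : Matrix V V ℂ)) (ℂ ∙ (1 : Matrix W W ℂ)) =
      ℂ ∙ (1 : Matrix (V × W) (V × W) ℂ) := by
  refine le_antisymm (Submodule.span_le.2 ?_) (Submodule.span_le.2 ?_)
  · rintro _ ⟨A, hA, B, hB, rfl⟩
    obtain ⟨a, rfl⟩ := Submodule.mem_span_singleton.1 hA
    obtain ⟨b, rfl⟩ := Submodule.mem_span_singleton.1 hB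
    rw [Matrix.smul_kronecker, Matrix.kronecker_smul, Matrix.one_kronecker_one]
    exact Submodule.smul_mem _ _ (Submodule.smul_mem _ _ (Submodule.mem_span_singleton_self _))
  · rintro _ rfl
    have hkron := kron_mem (Submodule.mem_span_singleton_self (R := ℂ) (1 : Matrix V V ℂ))
      (Submodule.mem_span_singleton_self (R := ℂ) (1 : Matrix W W ℂ))
    rwa [Matrix.one_kronecker_one] at hkron

theorem conjTranspose_vecMulVec_single_mul {V W : Type*} [DecidableEq V] [Fintype W]
    (u w : EuclideanSpace ℂ W) (x y : V) :
    (Matrix.vecMulVec u.ofLp (Pi.single x 1))ᴴ * Matrix.vecMulVec w.ofLp (Pi.single y 1) =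
      inner ℂ u w • Matrix.single x y (1 : ℂ) := by
  rw [Matrix.conjTranspose_vecMulVec, Matrix.vecMulVec_mul_vecMulVec,
    EuclideanSpace.inner_eq_star_dotProduct, dotProduct_comm, Matrix.vecMulVec_smul,
    Matrix.single_eq_single_vecMulVec_single, ← Pi.single_star, star_one]

section Channels

variable {V W : Type} [Fintype V] [DecidableEq V] [Fintype W] [DecidableEq W]

theorem spaceIso_scalars (e : V ≃ W) :
    SpaceIso (ℂ ∙ (1 : Matrix V V ℂ)) (ℂ ∙ (1 : Matrix W W ℂ)) := by
  refine SpaceIso.of_equiv e (fun A hA => ?_) (fun B hB => ?_)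
  · obtain ⟨c, rfl⟩ := Submodule.mem_span_singleton.1 hA
    refine Submodule.mem_span_singleton.2 ⟨c, ?_⟩
    rw [Matrix.submatrix_smul, Pi.smul_apply, Pi.smul_apply, Matrix.submatrix_one_equiv]
  · obtain ⟨c, rfl⟩ := Submodule.mem_span_singleton.1 hB
    refine Submodule.mem_span_singleton.2 ⟨c, ?_⟩
    rw [Matrix.submatrix_smul, Pi.smul_apply, Pi.smul_apply, Matrix.submatrix_one_equiv]

theorem spaceCohom_scalars_of_injective {e : V → W} (he : Function.Injective e) :
    SpaceCohom (ℂ ∙ (1 : Matrix V V ℂ)) (ℂ ∙ (1 : Matrix W W ℂ)) := by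
  have hE : ((1 : Matrix W W ℂ).submatrix id e)ᴴ * (1 : Matrix W W ℂ).submatrix id e = 1 := by
    rw [Matrix.conjTranspose_submatrix, Matrix.conjTranspose_one,
      ← Matrix.submatrix_mul _ _ _ id _ Function.bijective_id, Matrix.one_mul,
      Matrix.submatrix_one e he]
  refine ⟨Unit, inferInstance, fun _ => (1 : Matrix W W ℂ).submatrix id e, by simpa using hE, ?_⟩
  rintro - - A hA
  obtain ⟨c, rfl⟩ := Submodule.mem_span_singleton.1 hA
  rw [Matrix.mul_smul, Matrix.smul_mul, Matrix.mul_one, hE]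
  exact Submodule.smul_mem _ _ (Submodule.mem_span_singleton_self _)

theorem spaceCohom_graphSpace_scalars {G : SimpleGraph V} {v : V → EuclideanSpace ℂ W}
    (hv : ∀ x, v x ≠ 0) (horth : ∀ x y, ¬ AdjEq G x y → inner ℂ (v x) (v y) = 0) :
    SpaceCohom (graphSpace G) (ℂ ∙ (1 : Matrix W W ℂ)) := by
  set u : V → EuclideanSpace ℂ W := fun x => (‖v x‖⁻¹ : ℂ) • v x
  have hu_self (x : V) : inner ℂ (u x) (u x) = 1 :=
    inner_self_eq_one_of_norm_eq_one (norm_smul_inv_norm (hv x))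
  have hu_orth (x y : V) (hxy : ¬ AdjEq G x y) : inner ℂ (u x) (u y) = 0 := by
    rw [inner_smul_left, inner_smul_right, horth x y hxy, mul_zero, mul_zero]
  refine ⟨V, inferInstance, fun x => Matrix.vecMulVec (u x).ofLp (Pi.single x 1), ?_, ?_⟩
  · simp only [conjTranspose_vecMulVec_single_mul, hu_self, one_smul]
    exact Matrix.sum_single_one
  · intro x y A hA
    obtain ⟨c, rfl⟩ := Submodule.mem_span_singleton.1 hA
    rw [Matrix.mul_smul, Matrix.smul_mul, Matrix.mul_one, conjTranspose_vecMulVec_single_mul]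
    refine Submodule.smul_mem _ _ ?_
    by_cases hxy : AdjEq G x y
    · exact Submodule.smul_mem _ _ (Submodule.subset_span ⟨x, y, hxy, rfl⟩)
    · rw [hu_orth x y hxy, zero_smul]
      exact Submodule.zero_mem _

theorem spaceCohom_graphSpace_nonorthogonalityGraph {v : V → W → ℤ} (hv : ∀ x, v x ≠ 0) :
    SpaceCohom (graphSpace (nonorthogonalityGraph v)) (ℂ ∙ (1 : Matrix W W ℂ)) := by
  have hinner (x y : V) : inner ℂ (WithLp.toLp 2 fun i => (v x i : ℂ) : EuclideanSpace ℂ W)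
      (WithLp.toLp 2 fun i => (v y i : ℂ)) = ((v x ⬝ᵥ v y : ℤ) : ℂ) := by
    simp [PiLp.inner_apply, dotProduct, mul_comm]
  refine spaceCohom_graphSpace_scalars
    (v := fun x => WithLp.toLp 2 fun i => (v x i : ℂ)) (fun x h => ?_) fun x y hxy => ?_
  · exact hv x (funext fun i => by simpa using congrArg (fun u => u.ofLp i) h)
  · rw [hinner, Int.cast_eq_zero]
    by_contra hne
    exact hxy (or_iff_not_imp_left.2 fun h => ⟨h, hne⟩)

end Channels

theorem idealQuantumA_one : idealQuantumA 1 = 1 :=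
  Subtype.ext (Quotient.sound (spaceIso_scalars (Equiv.equivPUnit (Fin 1))))

theorem idealQuantumA_mul (m n : ℕ) :
    idealQuantumA (m * n) = idealQuantumA m * idealQuantumA n := by
  refine Subtype.ext (Quotient.sound ?_)
  change SpaceIso (ℂ ∙ (1 : Matrix (Fin (m * n)) (Fin (m * n)) ℂ))
    (tensorSpace (ℂ ∙ (1 : Matrix (Fin m) (Fin m) ℂ)) (ℂ ∙ (1 : Matrix (Fin n) (Fin n) ℂ)))
  rw [tensorSpace_scalars]
  exact spaceIso_scalars finProdFinEquiv.symm

theorem idealQuantumA_mono : Monotone idealQuantumA := fun _ _ h =>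
  spaceCohom_scalars_of_injective (Fin.castLE_injective h)

/-- The multiplicative family of noiseless quantum channels, `d ↦ 𝒬_d`. -/
noncomputable def idealQuantumHom : ℕ →* semiringA where
  toFun := idealQuantumA
  map_one' := idealQuantumA_one
  map_mul' := idealQuantumA_mul

theorem graphA_signGraph_le (m : ℕ) :
    graphA (Quotient.mk _ (signGraph m)) ≤ idealQuantumA (m + 2) :=
  spaceCohom_graphSpace_nonorthogonalityGraph fun x (h : signExtension x = 0) =>
    one_ne_zero (congrFun h 0)

theorem mainTheorem3_general {F : semiringA →* ℝ≥0} (hF : Monotone F) :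
    ∃ G : GraphClass, (F (graphA G) : ℝ) < fractionalCliqueCover G := by
  obtain ⟨a, ha⟩ := exists_forall_map_le_two_mul_pow (f := F.comp idealQuantumHom)
    (hF.comp idealQuantumA_mono)
  obtain ⟨p, hp, hlt, hp2⟩ := ((Nat.frequently_atTop_iff_infinite.2
    Nat.infinite_setOfPred_prime).and_eventually
    ((eventually_const_mul_pow_mul_pow_lt (r := 3125) (s := 4096) (by norm_num) (4 * 8 ^ a) a).and
      (Filter.eventually_gt_atTop 2))).exists
  obtain ⟨m, hm⟩ : ∃ m, m + 2 = 4 * p := ⟨4 * p - 2, by omega⟩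
  refine ⟨Quotient.mk _ (signGraph m), ?_⟩
  have hupper : (F (graphA (Quotient.mk _ (signGraph m))) : ℝ) ≤ (8 * p) ^ a := by
    refine (NNReal.coe_le_coe.2 ((hF (graphA_signGraph_le m)).trans (ha _ (by omega)))).trans_eq ?_
    rw [hm]
    push_cast
    ring
  have hlower := pow_le_mul_fractionalCliqueCover_signGraph hp (hp.odd_of_ne_two hp2.ne') hm
  by_contra! hle
  have hle_pow : 4 * 3125 ^ p * fractionalCliqueCover (Quotient.mk _ (signGraph m)) ≤
      4 * 8 ^ a * (p ^ a * 3125 ^ p) := by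
    calc _ ≤ 4 * 3125 ^ p * (8 * p : ℝ) ^ a := by gcongr; exact hle.trans hupper
      _ = 4 * 8 ^ a * (p ^ a * 3125 ^ p) := by rw [mul_pow]; ring
  exact (hlower.trans hle_pow).not_gt hlt

theorem mainTheorem3 :
    (¬ ∃ F ∈ asymptoticSpectrum semiringA,
      ∀ G : GraphClass, (F (graphA G) : ℝ) = fractionalCliqueCover G) ∧
    ∀ α : ℝ, ¬ IsAdmissibleExponent fractionalCliqueCover α := by
  have no_extension (F : semiringA →+* ℝ≥0) (hF : Monotone F) :
      ¬ ∀ G : GraphClass, (F (graphA G) : ℝ) = fractionalCliqueCover G := fun hFG =>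
    have ⟨G, hG⟩ := mainTheorem3_general (F := (F : semiringA →* ℝ≥0)) hF
    hG.ne (hFG G)
  refine ⟨fun ⟨F, hF, hFG⟩ => no_extension F hF hFG, fun α ⟨_, F, hF, h⟩ => ?_⟩
  exact no_extension F hF fun G => by simpa [idealQuantumA_one] using h 1 fun _ => G
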